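/- Theorem 1.5. Let $\kappa\le\lambda$ be regular cardinals. Let $E^\lambda_{<\kappa}$ be the set of ordinals $\alpha<\lambda$ with $\mathrm{cf}(\alpha)<\kappa$, and let $\mathcal P_\kappa\lambda$ be the set of all $x\subseteq\lambda$ with $|x|<\kappa$. A set of ordinals $T$ is called stationary in an ordinal $\alpha$ if $\mathrm{cf}(\alpha)>\omega$ and $T$ meets every closed unbounded subset of $\alpha$; otherwise $T$ is non-stationary in $\alpha$. Suppose there is a set $S\subseteq E^\lambda_{<\kappa}$ that is stationary in $\lambda$ (so in particular $\lambda$ is uncountable) and such that $S\cap\alpha$ is non-stationary in $\alpha$ for every $\alpha\in E^\lambda_{<\kappa}$. Then $\mathcal P_\kappa\lambda\not\to[I_{\kappa\lambda}^+]^3_\lambda$. That is, there is a coloring $c:[\mathcal P_\kappa\lambda]^3\to\lambda$ of the three-element subsets of $\mathcal P_\kappa\lambda$ such that for every unbounded $X\subseteq\mathcal P_\kappa\lambda$ (every $a\in\mathcal P_\kappa\lambda$ is contained in some $x\in X$) and every $\xi<\lambda$ there are $x_0,x_1,x_2\in X$ with $x_0\subsetneq x_1\subsetneq x_2$ and $c(\{x_0,x_1,x_2\})=\xi$.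 -/

import Mathlib

universe u

/-- `E^lam_{<κ}`: the ordinals below `lam` of cofinality less than `κ`. -/
def cofBelow (lam κ : Cardinal.{u}) : Set Ordinal.{u} :=
  {α | α < lam.ord ∧ α.cof < κ}

/-- `S` is stationary in the ordinal `α`: `α` has uncountable cofinality and `S` meets every
closed unbounded subset of `α`. As usual, stationarity is a notion for ordinals of uncountable
cofinality only: nothing is stationary in `0`, in a successor, or in an ordinal of cofinality
`ω`. -/
def IsStationaryIn (S : Set Ordinal.{u}) (α : Ordinal.{u}) : Prop :=
  Cardinal.aleph0 < α.cof ∧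
    IsStationary ((Subtype.val : Set.Iio α → Ordinal.{u}) ⁻¹' S)

/-- `P_κ(lam)`: the subsets of `lam` of cardinality less than `κ`, ordered by inclusion. -/
abbrev PKappa (κ lam : Cardinal.{u}) : Type (u + 1) :=
  {x : Set Ordinal.{u} // x ⊆ Set.Iio lam.ord ∧ Cardinal.mk x < Cardinal.lift.{u + 1, u} κ}

/-- Membership in the bounded ideal `I_{κ,lam}` over `P_κ(lam)`: some `a ∈ P_κ(lam)` is not
contained in any member of `X`. -/
def IsBoundedFamily {κ lam : Cardinal.{u}} (X : Set (PKappa κ lam)) : Prop :=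
  ∃ a : PKappa κ lam, ∀ x ∈ X, ¬ a.1 ⊆ x.1

/-- `[A]^n`: the `n`-element subsets of a type `A`. -/
abbrev NSubsets (A : Type*) (n : ℕ) : Type _ := {s : Finset A // s.card = n}

/-- `[X]^n_⊂`: the sets `{x₀, …, xₙ₋₁} ⊆ X` with `x₀ ⊂ ⋯ ⊂ xₙ₋₁` (proper inclusions). -/
def increasingSubsets {κ lam : Cardinal.{u}} (X : Set (PKappa κ lam)) (n : ℕ) :
    Set (NSubsets (PKappa κ lam) n) :=
  {s | ∃ x : Fin n → PKappa κ lam,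
    (∀ i, x i ∈ X) ∧ (∀ i j, i < j → (x i).1 ⊂ (x j).1) ∧ (s.1 : Set (PKappa κ lam)) = Set.range x}

/-- The negative square bracket relation `P_κ(lam) ↛ [I⁺_{κ,lam}]^n_lam`: some coloring of
`[P_κ(lam)]^n` by the ordinals below `lam` takes every value on `[X]^n_⊂`, for each `X` that is
positive for the bounded ideal. -/
def NegSquareBracket (κ lam : Cardinal.{u}) (n : ℕ) : Prop :=
  ∃ c : NSubsets (PKappa κ lam) n → Set.Iio lam.ord,
    ∀ X : Set (PKappa κ lam), ¬ IsBoundedFamily X → c '' increasingSubsets X n = Set.univ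

/-! Each γ < λ of cofinality < κ carries a cofinal ladder that accumulates at no limit point of S,
because S does not reflect at γ (`exists_isLadder`). Given x₀ ⊂ x₁ ⊂ x₂, walk down from λ towards
sup x₀ and sup x₁, first replacing each visited γ by the strict supremum of x₂ ∩ γ, which has
cofinality < κ and hence a ladder. The color depends on the last common point of the two walks.

If δ ∈ S ∩ x₂ is a limit, non-accumulation makes all walks towards points close enough below δ pass
through δ (`exists_walkSplit_eq`). If moreover x₂ is cofinal in δ and a ladder point of δ separates
the two suprema, the walks part exactly at δ. An unbounded X realizes this for some δ in any
prescribed stationary T ⊆ S of limits (`exists_increasing_triple`). The same ladders split S into λ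
stationary pieces (`IsStationary.exists_partition`); the color is the index of the piece. -/

/-! ### Clubs, pressing down, and splitting a stationary set -/

section Club

open Cardinal Order Set

variable {α : Type*} [LinearOrder α] {S T : Set α}

theorem noMaxOrder_of_aleph0_lt_cof (hα : ℵ₀ < Order.cof α) : NoMaxOrder α := by
  by_contra h
  rw [← noTopOrder_iff_noMaxOrder, ← cof_ne_one_iff, not_not] at h
  exact (hα.trans' one_lt_aleph0).ne' h

theorem isClub_Ioi [NoMaxOrder α] (a : α) : IsClub (Ioi a) := by
  refine ⟨fun d hd hd₀ _ x hx ↦ ?_, fun b ↦ ?_⟩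
  · obtain ⟨z, hz⟩ := hd₀
    exact (hd hz : a < z).trans_le (hx.1 hz)
  · obtain ⟨x, hx⟩ := exists_gt (max a b)
    exact ⟨x, (le_max_left a b).trans_lt hx, (le_max_right a b).trans hx.le⟩

variable [WellFoundedLT α]

theorem IsStationary.inter_isClub (hα : ℵ₀ < Order.cof α) (hS : IsStationary S) (hT : IsClub T) :
    IsStationary (S ∩ T) := fun _ hU ↦ by
  simpa only [inter_assoc] using hS (hT.inter hα.ne' hU)

variable [IsRegularCardinalOrder α]

theorem mk_Iio_lt_cof (a : α) : #(Iio a) < Order.cof α := by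
  rw [cof_eq_cardinalMk]
  have h := Ordinal.typein_lt_type (α := α) (· < ·) a
  rw [← Cardinal.ord_cardinalMk, Cardinal.lt_ord] at h
  exact h

theorem IsClub.diagonal (hα : ℵ₀ < Order.cof α) {C : α → Set α} (hC : ∀ a, IsClub (C a)) :
    IsClub {x | ∀ a < x, x ∈ C a} := by
  have := noMaxOrder_of_aleph0_lt_cof hα
  refine ⟨fun d hd hd₀ _ x hx a ha ↦ ?_, fun a ↦ ?_⟩
  · obtain ⟨z, hz, haz⟩ := (lt_isLUB_iff hx).1 ha
    refine (hC a).isLUB_mem (t := {w ∈ d | a < w}) (fun w hw ↦ hd hw.1 a hw.2) ⟨z, hz, haz⟩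
      ⟨fun w hw ↦ hx.1 hw.1, fun b hb ↦ hx.2 fun w hw ↦ ?_⟩
    rcases lt_or_ge a w with h | h
    · exact hb ⟨hw, h⟩
    · exact h.trans (haz.le.trans (hb ⟨hz, haz⟩))
  · have step (b : α) : ∃ x, b < x ∧ ∀ y ≤ b, x ∈ C y := by
      obtain ⟨b', hb'⟩ := exists_gt b
      have hI : IsClub (⋂ y : Iio b', C y) := by
        refine IsClub.iInter hα.ne' ?_ fun y ↦ hC y
        simpa using mk_Iio_lt_cof b'
      obtain ⟨x, hx, hbx⟩ := hI.isCofinal b'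
      exact ⟨x, hb'.trans_le hbx, fun y hy ↦ mem_iInter.1 hx ⟨y, hy.trans_lt hb'⟩⟩
    -- The supremum of the ω-sequence of iterates of `g` lies in the diagonal intersection.
    choose g hg hgC using step
    have hmono : StrictMono fun n : ℕ ↦ g^[n] a :=
      strictMono_nat_of_lt_succ fun n ↦ by
        simpa only [Function.iterate_succ_apply'] using hg _
    have hbdd : BddAbove (range fun n : ℕ ↦ g^[n] a) := by
      refine .of_not_isCofinal fun h ↦ (cof_le h).not_gt (hα.trans_le' ?_)
      simpa using mk_range_le_lift (f := fun n : ℕ ↦ g^[n] a)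
    obtain ⟨x, hx, hmin⟩ := wellFounded_lt.has_min
      (upperBounds (range fun n : ℕ ↦ g^[n] a)) hbdd
    have hlub : IsLUB (range fun n : ℕ ↦ g^[n] a) x := ⟨hx, fun b hb ↦ not_lt.1 (hmin b hb)⟩
    refine ⟨x, fun b hb ↦ ?_, hx ⟨0, rfl⟩⟩
    obtain ⟨_, ⟨n, rfl⟩, hn⟩ := (lt_isLUB_iff hlub).1 hb
    refine (hC b).isLUB_mem (t := range fun m : ℕ ↦ g^[n + m + 1] a) ?_ (range_nonempty _)
      ⟨?_, fun c hc ↦ hlub.2 ?_⟩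
    · rintro _ ⟨m, rfl⟩
      simp only [Function.iterate_succ_apply']
      exact hgC _ _ (hn.le.trans (hmono.monotone (Nat.le_add_right n m)))
    · rintro _ ⟨m, rfl⟩
      exact hx ⟨_, rfl⟩
    · rintro _ ⟨m, rfl⟩
      exact (hmono.monotone (by omega : m ≤ n + m + 1)).trans (hc ⟨m, rfl⟩)

theorem isClub_closedUnder (hα : ℵ₀ < Order.cof α) (f : α → α) :
    IsClub {x | ∀ a < x, f a < x} :=
  have := noMaxOrder_of_aleph0_lt_cof hα
  IsClub.diagonal hα fun a ↦ isClub_Ioi (f a)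

theorem isClub_closedUnder₂ (hα : ℵ₀ < Order.cof α) (f : α → α → α) :
    IsClub {x | ∀ a < x, ∀ b < x, f a b < x} :=
  IsClub.diagonal hα fun a ↦ isClub_closedUnder hα (f a)

theorem isClub_setOf_isSuccLimit (hα : ℵ₀ < Order.cof α) : IsClub {x : α | IsSuccLimit x} := by
  have := noMaxOrder_of_aleph0_lt_cof hα
  have : Nonempty α := by
    by_contra h
    rw [not_nonempty_iff] at h
    simp at hα
  choose f hf using fun a : α ↦ exists_gt a
  obtain ⟨b, -, hb⟩ := wellFounded_lt.has_min (univ : Set α) univ_nonempty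
  have h := (isClub_closedUnder hα f).inter hα.ne' (isClub_Ioi b)
  refine ⟨fun d hd hd₀ _ x hx ↦ ?_, h.isCofinal.mono fun x hx ↦ ?_⟩
  · obtain ⟨z, hz⟩ := hd₀
    by_cases hxd : x ∈ d
    · exact hd hxd
    refine ⟨fun hmin ↦ (hd hz).1 (hmin.mono (hx.1 hz)), fun w hw ↦ ?_⟩
    obtain ⟨v, hv, hwv⟩ := (lt_isLUB_iff hx).1 hw.lt
    exact hw.2 hwv ((hx.1 hv).lt_of_ne fun h ↦ hxd (h ▸ hv))
  · exact ⟨fun hmin ↦ (hmin (le_of_lt hx.2)).not_gt hx.2, fun w hw ↦ hw.2 (hf w) (hx.1 w hw.lt)⟩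

/-- Fodor's pressing down lemma. -/
theorem IsStationary.exists_isStationary_preimage (hα : ℵ₀ < Order.cof α) (hS : IsStationary S)
    (f : α → α) (hf : ∀ a ∈ S, f a < a) : ∃ b, IsStationary (S ∩ f ⁻¹' {b}) := by
  by_contra! h
  simp_rw [not_isStationary_iff] at h
  choose K hK hdisj using h
  obtain ⟨a, haS, ha⟩ := hS (IsClub.diagonal hα hK)
  exact (hdisj (f a)).le_bot ⟨⟨haS, rfl⟩, ha _ (hf a haS)⟩

/-- A stationary set carrying a ladder system none of whose ladders accumulates at a point of the
set splits into as many stationary sets as there are points. -/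
theorem IsStationary.exists_partition (hα : ℵ₀ < Order.cof α) (hS : IsStationary S)
    (C : α → Set α) (hcof : ∀ x ∈ S, ∀ a < x, ∃ c ∈ C x, a ≤ c ∧ c < x)
    (hacc : ∀ x ∈ S, ∀ y ∈ S, y < x → ∃ a < y, ∀ c ∈ C x, c < y → c < a) :
    ∃ f : α → α, ∀ b, IsStationary (S ∩ f ⁻¹' {b}) := by
  classical
  have := noMaxOrder_of_aleph0_lt_cof hα
  have hn (x a : α) : ∃ c, x ∈ S → a < x → c ∈ C x ∧ a ≤ c ∧ c < x := by
    by_cases h : x ∈ S ∧ a < x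
    · obtain ⟨c, hc⟩ := hcof x h.1 a h.2
      exact ⟨c, fun _ _ ↦ hc⟩
    · exact ⟨a, fun h₁ h₂ ↦ (h ⟨h₁, h₂⟩).elim⟩
  choose n hn using hn
  -- Otherwise `n x a` is bounded by some `e a` for club-almost all `x`. For `y < x` in S with `y`
  -- closed under `e` and `x` in the diagonal intersection, the ladder of `x` then accumulates at
  -- `y`.
  obtain ⟨a, ha⟩ : ∃ a, ∀ b, IsStationary {x ∈ S | a < x ∧ b ≤ n x a} := by
    by_contra! h
    choose e he using h
    simp_rw [not_isStationary_iff] at he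
    choose K hK hdisj using he
    have hT := hS.inter_isClub hα
      ((IsClub.diagonal hα hK).inter hα.ne' (isClub_closedUnder hα e))
    obtain ⟨y, ⟨hyS, -, hye⟩, -⟩ := hT .univ
    obtain ⟨x, ⟨hxS, hxK, -⟩, hyx : y < x⟩ := hT (isClub_Ioi y)
    obtain ⟨a, hay, hac⟩ := hacc x hxS y hyS hyx
    obtain ⟨hnC, hna, -⟩ := hn x a hxS (hay.trans hyx)
    have hlt : n x a < e a := by
      by_contra! hle
      exact (hdisj a).le_bot ⟨⟨hxS, hay.trans hyx, hle⟩, hxK a (hay.trans hyx)⟩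
    exact (hac _ hnC (hlt.trans (hye a hay))).not_ge hna
  have hΓ : IsCofinal {b | IsStationary (S ∩ (n · a) ⁻¹' {b})} := fun b ↦ by
    obtain ⟨c, hc⟩ := (ha b).exists_isStationary_preimage hα (n · a)
      fun x hx ↦ (hn x a hx.1 hx.2.1).2.2
    obtain ⟨x, ⟨⟨-, -, hbx⟩, rfl⟩, -⟩ := hc .univ
    exact ⟨n x a, hc.mono (inter_subset_inter_left _ fun y hy ↦ hy.1), hbx⟩
  -- The values with stationary fibre are cofinal, so by regularity they are order isomorphic to all
  -- of `α` and can be reindexed.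
  refine ⟨fun x ↦ if h : n x a ∈ {b | IsStationary (S ∩ (n · a) ⁻¹' {b})}
    then (Order.enum _ hΓ).symm ⟨n x a, h⟩ else x, fun b ↦ ?_⟩
  refine (Order.enum _ hΓ b).2.mono fun x hx ↦ ⟨hx.1, ?_⟩
  have hx' : n x a = (Order.enum _ hΓ b).1 := hx.2
  have hmem : n x a ∈ {b | IsStationary (S ∩ (n · a) ⁻¹' {b})} := hx' ▸ (Order.enum _ hΓ b).2
  simp only [mem_preimage, mem_singleton_iff]
  rw [dif_pos hmem, OrderIso.symm_apply_eq]
  exact Subtype.ext hx'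

end Club

/-! ### Ladders and walks -/

section Walk

open Cardinal Order Set

theorem Cardinal.IsRegular.isRegularCardinalOrder_Iio_ord {lam : Cardinal.{u}}
    (hlam : lam.IsRegular) : IsRegularCardinalOrder (Iio lam.ord) where
  type_lt_le_ord_cof := by
    rw [Ordinal.cof_Iio, ← Ordinal.lift_cof, hlam.cof_ord, Ordinal.type_lt_Iio,
      Cardinal.lift_ord]

theorem Cardinal.IsRegular.cof_Iio_ord {lam : Cardinal.{u}} (hlam : lam.IsRegular) :
    Order.cof (Iio lam.ord) = Cardinal.lift.{u + 1} lam := by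
  rw [Ordinal.cof_Iio, ← Ordinal.lift_cof, hlam.cof_ord]

/-- A ladder for `γ` relative to `S`: a cofinal subset of `γ` which does not accumulate at any
element of `S` below `γ`. -/
structure IsLadder (S : Set Ordinal.{u}) (γ : Ordinal.{u}) (C : Set Ordinal.{u}) : Prop where
  lt : ∀ c ∈ C, c < γ
  exists_le : ∀ a < γ, ∃ c ∈ C, a ≤ c
  exists_bound : ∀ δ ∈ S, δ < γ → ∃ a < δ, ∀ c ∈ C, c < δ → c < a

/-- In cofinality ω, a ladder of type at most ω has only finitely many points below any δ < γ. In
uncountable cofinality, a club disjoint from S works, since a closed set contains its accumulation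
points below γ. -/
theorem exists_isLadder {S : Set Ordinal.{u}} (hlim : ∀ δ ∈ S, IsSuccLimit δ) {γ : Ordinal.{u}}
    (hγ : ¬ IsStationaryIn (S ∩ Iio γ) γ) : ∃ C, IsLadder S γ C := by
  rcases Ordinal.zero_or_succ_or_isSuccLimit γ with rfl | ⟨β, rfl⟩ | hγlim
  · exact ⟨∅, by simp, by simp, by simp⟩
  · refine ⟨{β}, by simp, fun a ha ↦ ⟨β, rfl, lt_succ_iff.1 ha⟩, fun δ hδ hδγ ↦
      ⟨⊥, (hlim δ hδ).bot_lt, ?_⟩⟩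
    rintro _ rfl h
    exact absurd (lt_succ_iff.1 hδγ) h.not_ge
  have hcof : ℵ₀ ≤ γ.cof := Ordinal.aleph0_le_cof_iff.2 (Ordinal.one_lt_cof_iff.2 hγlim)
  rcases hcof.eq_or_lt with hω | hω
  · obtain ⟨A, hA, hAcard⟩ := Order.exists_cof_eq (Iio γ)
    rw [Ordinal.cof_Iio, ← Ordinal.lift_cof, ← hω, lift_aleph0] at hAcard
    obtain ⟨e⟩ : Nonempty (ℕ ≃ A) := by
      rw [← Cardinal.lift_mk_eq', hAcard]
      simp
    let g : ℕ → Ordinal.{u} := fun n ↦ (Finset.range (n + 1)).sup' ⟨0, by simp⟩ fun i ↦ (e i).1.1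
    have hg (n : ℕ) : g n < γ := (Finset.sup'_lt_iff _).2 fun i _ ↦ (e i).1.2
    have hle {i n : ℕ} (h : i ≤ n) : (e i).1.1 ≤ g n :=
      Finset.le_sup' (fun i ↦ (e i).1.1) (by simpa [Nat.lt_succ_iff] using h)
    refine ⟨range g, ?_, fun a ha ↦ ?_, fun δ hδ hδγ ↦ ?_⟩
    · rintro _ ⟨n, rfl⟩
      exact hg n
    · obtain ⟨b, hb, hab⟩ := hA ⟨a, ha⟩
      refine ⟨_, ⟨e.symm ⟨b, hb⟩, rfl⟩, le_trans ?_ (hle le_rfl)⟩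
      rw [Equiv.apply_symm_apply]
      exact hab
    · obtain ⟨b, hb, hab⟩ := hA ⟨δ, hδγ⟩
      let m := e.symm ⟨b, hb⟩
      have hm {n : ℕ} (h : m ≤ n) : δ ≤ g n := by
        refine le_trans ?_ (hle h)
        rw [Equiv.apply_symm_apply]
        exact hab
      refine ⟨((Finset.range m).filter (g · < δ)).sup fun n ↦ succ (g n), ?_, ?_⟩
      · rw [Finset.sup_lt_iff (hlim δ hδ).bot_lt]
        intro n hn
        exact (hlim δ hδ).succ_lt (Finset.mem_filter.1 hn).2
      · rintro _ ⟨n, rfl⟩ hn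
        have hnm : n < m := not_le.1 fun h ↦ (hm h).not_gt hn
        exact succ_le_iff.1 (Finset.le_sup (f := fun n ↦ succ (g n))
          (Finset.mem_filter.2 ⟨Finset.mem_range.2 hnm, hn⟩))
  · simp only [IsStationaryIn, hω, true_and, not_isStationary_iff] at hγ
    obtain ⟨D, hD, hdisj⟩ := hγ
    refine ⟨Subtype.val '' D, ?_, fun a ha ↦ ?_, fun δ hδ hδγ ↦ ?_⟩
    · rintro _ ⟨c, -, rfl⟩
      exact c.2
    · obtain ⟨c, hc, hac⟩ := hD.isCofinal ⟨a, ha⟩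
      exact ⟨c, ⟨c, hc, rfl⟩, hac⟩
    · by_contra! h
      have hδD : (⟨δ, hδγ⟩ : Iio γ) ∉ D := Set.disjoint_left.1 hdisj ⟨hδ, hδγ⟩
      apply hδD
      refine hD.isLUB_mem (t := {c ∈ D | c.1 < δ}) (fun c hc ↦ hc.1) ?_
        ⟨fun c hc ↦ le_of_lt hc.2, fun b hb ↦ le_of_not_gt fun hbδ ↦ ?_⟩
      · obtain ⟨_, ⟨c, hc, rfl⟩, hcδ, -⟩ := h ⊥ (hlim δ hδ).bot_lt
        exact ⟨c, hc, hcδ⟩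
      · obtain ⟨_, ⟨c, hc, rfl⟩, hcδ, hbc⟩ := h (succ b.1) ((hlim δ hδ).succ_lt hbδ)
        have hcb : c.1 ≤ b.1 := hb ⟨hc, hcδ⟩
        exact hcb.not_gt (succ_le_iff.1 hbc)

/-- The least ordinal greater than all elements of `x`. -/
noncomputable def strictSup (x : Set Ordinal.{u}) : Ordinal.{u} := ⨆ i : x, i.1 + 1

section StrictSup

variable {x y : Set Ordinal.{u}} {a γ : Ordinal.{u}} {κ lam : Cardinal.{u}}

theorem lt_strictSup (hx : BddAbove x) (ha : a ∈ x) : a < strictSup x := by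
  have : Small.{u} x := Ordinal.bddAbove_iff_small.1 hx
  exact Ordinal.lt_iSup_add_one (fun i : x ↦ i.1) ⟨a, ha⟩

theorem strictSup_le (h : ∀ i ∈ x, i < a) : strictSup x ≤ a :=
  Ordinal.iSup_le fun i ↦ add_one_le_of_lt (h i i.2)

theorem strictSup_mono (hy : BddAbove y) (h : x ⊆ y) : strictSup x ≤ strictSup y :=
  strictSup_le fun _ hi ↦ lt_strictSup hy (h hi)

theorem strictSup_lt_ord (hlam : lam.IsRegular) (hx : x ⊆ Iio lam.ord)
    (hcard : #x < Cardinal.lift.{u + 1} lam) : strictSup x < lam.ord := by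
  refine Ordinal.lift_iSup_add_one_lt_of_lt_cof ?_ fun i ↦ hx i.2
  rwa [← Ordinal.lift_cof, hlam.cof_ord, Cardinal.lift_id'.{u, u + 1}]

theorem cof_strictSup_lt (hx : BddAbove x) (hcard : #x < Cardinal.lift.{u + 1} κ) :
    (strictSup x).cof < κ := by
  have : Small.{u} x := Ordinal.bddAbove_iff_small.1 hx
  have h := Ordinal.cof_lift_iSup_add_one_le (fun i : x ↦ i.1)
  rw [← Ordinal.lift_cof, Cardinal.lift_id'.{u, u + 1}] at h
  exact Cardinal.lift_lt.1 (h.trans_lt hcard)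

end StrictSup

/-- The next step of the walk from `γ` towards `a` along the ladder system `C`. -/
noncomputable def walkStep (C : Ordinal.{u} → Set Ordinal.{u}) (γ a : Ordinal.{u}) : Ordinal.{u} :=
  sInf {c ∈ C γ | a ≤ c}

open Classical in
/-- The last common point of the walks from `γ` towards `a` and `b`, where each point `ξ` that is
visited is first replaced by the strict supremum of `x ∩ ξ`. -/
noncomputable def walkSplit (C : Ordinal.{u} → Set Ordinal.{u}) (x : Set Ordinal.{u})
    (a b γ : Ordinal.{u}) : Ordinal.{u} :=
  -- The first conjunct secures termination for arbitrary `C`; it is automatic for a ladder when `a`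
  -- lies below the strict supremum.
  if _h : walkStep C (strictSup (x ∩ Iio γ)) a < γ ∧
      walkStep C (strictSup (x ∩ Iio γ)) b = walkStep C (strictSup (x ∩ Iio γ)) a then
    walkSplit C x a b (walkStep C (strictSup (x ∩ Iio γ)) a)
  else strictSup (x ∩ Iio γ)
termination_by γ
decreasing_by exact _h.1

section

variable {S : Set Ordinal.{u}} {C : Ordinal.{u} → Set Ordinal.{u}} {x : Set Ordinal.{u}}
  {a b γ δ : Ordinal.{u}} {κ lam : Cardinal.{u}}

theorem IsLadder.walkStep_mem (hC : IsLadder S γ (C γ)) (ha : a < γ) :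
    walkStep C γ a ∈ C γ ∧ a ≤ walkStep C γ a := by
  obtain ⟨c, hc, hac⟩ := hC.exists_le a ha
  exact csInf_mem (s := {c ∈ C γ | a ≤ c}) ⟨c, hc, hac⟩

/-- Since δ ∈ x, each replaced point above δ stays above δ, and its ladder misses an interval [e₁,
δ). Targets in that interval take the same step as δ, landing at or above δ; the descent reaches δ,
and `e` is the maximum of the finitely many thresholds. -/
theorem exists_walkSplit_eq (hlam : lam.IsRegular) (hle : κ ≤ lam)
    (hC : ∀ γ ∈ cofBelow lam κ, IsLadder S γ (C γ)) (hx : x ⊆ Iio lam.ord)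
    (hcard : #x < Cardinal.lift.{u + 1} κ) (hδS : δ ∈ S) (hδ : δ ≠ 0) (hδx : δ ∈ x)
    (hδγ : δ ≤ γ) :
    ∃ e < δ, ∀ a b, e ≤ a → a < δ → e ≤ b → b < δ → walkSplit C x a b γ = walkSplit C x a b δ := by
  induction γ using WellFoundedLT.induction with
  | _ γ ih =>
    rcases hδγ.eq_or_lt with rfl | hlt
    · exact ⟨0, pos_iff_ne_zero.2 hδ, fun _ _ _ _ _ _ ↦ rfl⟩
    have hsub : x ∩ Iio γ ⊆ Iio lam.ord := inter_subset_left.trans hx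
    have hbdd : BddAbove (x ∩ Iio γ) := bddAbove_Iio.mono hsub
    have hcard' : #↥(x ∩ Iio γ) < Cardinal.lift.{u + 1} κ :=
      (mk_le_mk_of_subset inter_subset_left).trans_lt hcard
    set γ' := strictSup (x ∩ Iio γ) with hγ'
    have hδγ' : δ < γ' := lt_strictSup hbdd ⟨hδx, hlt⟩
    have hγ'γ : γ' ≤ γ := strictSup_le fun i hi ↦ hi.2
    have hL : IsLadder S γ' (C γ') := hC _ ⟨strictSup_lt_ord hlam hsub
      (hcard'.trans_le (Cardinal.lift_le.2 hle)), cof_strictSup_lt hbdd hcard'⟩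
    obtain ⟨hn, hδn⟩ := hL.walkStep_mem hδγ'
    have hnγ : walkStep C γ' δ < γ := (hL.lt _ hn).trans_le hγ'γ
    obtain ⟨e₁, he₁, hbound⟩ := hL.exists_bound δ hδS hδγ'
    have hstep (a : Ordinal.{u}) (ha : e₁ ≤ a) (haδ : a < δ) :
        walkStep C γ' a = walkStep C γ' δ := by
      refine congrArg sInf (Set.ext fun c ↦ and_congr_right fun hc ↦
        ⟨fun hac ↦ ?_, fun hδc ↦ haδ.le.trans hδc⟩)
      by_contra! hcδ
      exact (hbound c hc hcδ).not_ge (ha.trans hac)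
    obtain ⟨e₂, he₂, heq⟩ := ih _ hnγ hδn
    refine ⟨max e₁ e₂, max_lt he₁ he₂, fun a b ha haδ hb hbδ ↦ ?_⟩
    rw [max_le_iff] at ha hb
    rw [walkSplit, ← hγ', hstep a ha.1 haδ, hstep b hb.1 hbδ, dif_pos ⟨hnγ, rfl⟩]
    exact heq a b ha.2 haδ hb.2 hbδ

theorem walkSplit_of_ne (h : strictSup (x ∩ Iio δ) = δ) (hab : walkStep C δ b ≠ walkStep C δ a) :
    walkSplit C x a b δ = δ := by
  rw [walkSplit, h, dif_neg fun h' ↦ hab h'.2]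

end

end Walk

/-! ### Coloring triples by the splitting point -/

section Coloring

open Cardinal Order Set

variable {κ lam : Cardinal.{u}}

/-- The splitting point read off from a strictly increasing triple in `P_κ(lam)`. -/
noncomputable def tripleSplit (C : Ordinal.{u} → Set Ordinal.{u}) (x : Fin 3 → PKappa κ lam) :
    Ordinal.{u} :=
  walkSplit C (x 2).1 (strictSup (x 0).1) (strictSup (x 1).1) lam.ord

open Classical in
/-- The coloring of triples obtained from a ladder system and a function on ordinals. -/
noncomputable def tripleColor (C : Ordinal.{u} → Set Ordinal.{u})
    (f : Ordinal.{u} → Iio lam.ord) (s : NSubsets (PKappa κ lam) 3) : Iio lam.ord :=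
  if h : ∃ x : Fin 3 → PKappa κ lam, StrictMono x ∧ (s.1 : Set (PKappa κ lam)) = range x then
    f (tripleSplit C h.choose)
  else f 0

theorem tripleColor_eq {C : Ordinal.{u} → Set Ordinal.{u}} {f : Ordinal.{u} → Iio lam.ord}
    {s : NSubsets (PKappa κ lam) 3} {x : Fin 3 → PKappa κ lam} (hx : StrictMono x)
    (hs : (s.1 : Set (PKappa κ lam)) = range x) : tripleColor C f s = f (tripleSplit C x) := by
  have h : ∃ x : Fin 3 → PKappa κ lam, StrictMono x ∧ (s.1 : Set (PKappa κ lam)) = range x :=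
    ⟨x, hx, hs⟩
  rw [tripleColor, dif_pos h, (h.choose_spec.1.range_inj hx).1 (h.choose_spec.2.symm.trans hs)]

theorem PKappa.bddAbove (x : PKappa κ lam) : BddAbove x.1 := bddAbove_Iio.mono x.2.1

theorem PKappa.strictSup_lt_ord (hlam : lam.IsRegular) (hle : κ ≤ lam) (x : PKappa κ lam) :
    strictSup x.1 < lam.ord :=
  _root_.strictSup_lt_ord hlam x.2.1 (x.2.2.trans_le (Cardinal.lift_le.2 hle))

theorem exists_mem_superset {X : Set (PKappa κ lam)} (hX : ¬ IsBoundedFamily X)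
    {a : Set Ordinal.{u}} (ha : a ⊆ Iio lam.ord) (hcard : #a < Cardinal.lift.{u + 1} κ) :
    ∃ x ∈ X, a ⊆ x.1 := by
  simp only [IsBoundedFamily] at hX
  push Not at hX
  exact hX ⟨a, ha, hcard⟩

theorem exists_increasing_triple (hκ : κ.IsRegular) (hlam : lam.IsRegular) (hle : κ ≤ lam)
    {S : Set Ordinal.{u}} {C : Ordinal.{u} → Set Ordinal.{u}} (hScof : S ⊆ cofBelow lam κ)
    (hlim : ∀ δ ∈ S, IsSuccLimit δ) (hC : ∀ γ ∈ cofBelow lam κ, IsLadder S γ (C γ))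
    (hω : ℵ₀ < lam) {T : Set (Iio lam.ord)} (hT : IsStationary T) (hTS : ∀ δ ∈ T, δ.1 ∈ S)
    {X : Set (PKappa κ lam)} (hX : ¬ IsBoundedFamily X) :
    ∃ x : Fin 3 → PKappa κ lam, (∀ i, x i ∈ X) ∧ StrictMono x ∧ ∃ δ ∈ T, tripleSplit C x = δ := by
  have := hlam.isRegularCardinalOrder_Iio_ord
  have hα : ℵ₀ < Order.cof (Iio lam.ord) := by
    rw [hlam.cof_Iio_ord, ← lift_aleph0.{u + 1, u}]
    exact Cardinal.lift_lt.2 hω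
  have hκ' : (Cardinal.lift.{u + 1} κ).IsRegular := hκ.lift
  have hfin {s : Set Ordinal.{u}} (hs : s.Finite) : #s < Cardinal.lift.{u + 1} κ :=
    hs.lt_aleph0.trans_le hκ'.aleph0_le
  have hy (ζ : Iio lam.ord) : ∃ x ∈ X, {ζ.1} ⊆ x.1 :=
    exists_mem_superset hX (by simp) (hfin (finite_singleton _))
  choose y hyX hζy using hy
  have hz (ζ η : Iio lam.ord) : ∃ x ∈ X, (y ζ).1 ∪ {η.1} ⊆ x.1 :=
    exists_mem_superset hX (union_subset (y ζ).2.1 (by simp))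
      ((mk_union_le _ _).trans_lt
        (Cardinal.add_lt_of_lt hκ'.aleph0_le (y ζ).2.2 (hfin (finite_singleton _))))
  choose z hzX hyz using hz
  -- Closure of δ keeps the suprema of all `z ζ η` with ζ, η < δ below δ.
  obtain ⟨δ, hδT, hδz⟩ := hT (isClub_closedUnder₂ hα
    fun ζ η ↦ ⟨strictSup (z ζ η).1, (z ζ η).strictSup_lt_ord hlam hle⟩)
  have hδS := hTS δ hδT
  have hδlim := hlim _ hδS
  obtain ⟨D, hD, hDcard⟩ := Order.exists_cof_eq (Iio δ.1)
  have hDκ : #D < Cardinal.lift.{u + 1} κ := by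
    rw [hDcard, Ordinal.cof_Iio, ← Ordinal.lift_cof]
    exact Cardinal.lift_lt.2 (hScof hδS).2
  let ι : Iio δ.1 → Iio lam.ord := fun d ↦ ⟨d.1, mem_Iio.2 (lt_trans d.2 δ.2)⟩
  -- The top set is chosen before ζ and η, as the threshold `e` depends on it. Hence it must contain
  -- every candidate `z`, with parameters from a cofinal `D` of size < κ.
  have hbig : ∃ x ∈ X, (({δ.1} ∪ Subtype.val '' D) ∪
      ⋃ p : D × D, (z (ι p.1) (ι p.2)).1) ⊆ x.1 := by
    refine exists_mem_superset hX ?_ ?_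
    · refine union_subset (union_subset (by simp) ?_)
        (iUnion_subset fun p ↦ (z _ _).2.1)
      rintro _ ⟨d, -, rfl⟩
      exact (ι d).2
    · refine (mk_union_le _ _).trans_lt (Cardinal.add_lt_of_lt hκ'.aleph0_le
        ((mk_union_le _ _).trans_lt (Cardinal.add_lt_of_lt hκ'.aleph0_le
          (hfin (finite_singleton _)) (mk_image_le.trans_lt hDκ))) ?_)
      refine (card_iUnion_lt_iff_forall_of_isRegular hκ' ?_).2 fun p ↦ (z _ _).2.2
      rw [← mul_def]
      exact Cardinal.mul_lt_of_lt hκ'.aleph0_le hDκ hDκ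
  obtain ⟨w, hwX, hw⟩ := hbig
  obtain ⟨⟨hδw, hDw⟩, hzw⟩ := by simpa only [union_subset_iff] using hw
  rw [singleton_subset_iff] at hδw
  obtain ⟨e, heδ, heq⟩ := exists_walkSplit_eq hlam hle hC w.2.1 w.2.2 hδS hδlim.ne_bot hδw
    (le_of_lt δ.2)
  have hDcof (a : Ordinal.{u}) (ha : a < δ.1) : ∃ d ∈ D, a ≤ d.1 :=
    hD ⟨a, ha⟩
  have hδsup : strictSup (w.1 ∩ Iio δ.1) = δ := by
    refine le_antisymm (strictSup_le fun i hi ↦ hi.2) (le_of_forall_lt fun a ha ↦ ?_)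
    obtain ⟨d, hd, had⟩ := hDcof a ha
    exact had.trans_lt (lt_strictSup (w.bddAbove.mono inter_subset_left)
      ⟨hDw ⟨d, hd, rfl⟩, d.2⟩)
  obtain ⟨ζ, hζD, heζ⟩ := hDcof e heδ
  have hL := hC δ (hScof hδS)
  have hsup (η : Iio δ.1) : strictSup (y (ι ζ)).1 ≤ strictSup (z (ι ζ) (ι η)).1 :=
    strictSup_mono (z (ι ζ) (ι η)).bddAbove (subset_union_left.trans (hyz (ι ζ) (ι η)))
  have hzδ (η : Iio δ.1) : strictSup (z (ι ζ) (ι η)).1 < δ.1 := hδz (ι ζ) ζ.2 (ι η) η.2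
  have hyδ : strictSup (y (ι ζ)).1 < δ.1 := (hsup ζ).trans_lt (hzδ ζ)
  have hey : e ≤ strictSup (y (ι ζ)).1 :=
    heζ.trans (lt_strictSup (y (ι ζ)).bddAbove (hζy (ι ζ) rfl)).le
  obtain ⟨hn, hyn⟩ := hL.walkStep_mem hyδ
  -- η is at or above the ladder point reached from `y`, so the supremum of `z` exceeds it and the
  -- next steps differ.
  obtain ⟨η, hηD, hnη⟩ := hDcof _ (hL.lt _ hn)
  have hnz : walkStep C δ (strictSup (y (ι ζ)).1) < strictSup (z (ι ζ) (ι η)).1 :=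
    hnη.trans_lt (lt_strictSup (z (ι ζ) (ι η)).bddAbove (hyz (ι ζ) (ι η) (Or.inr rfl)))
  have hyz' : y (ι ζ) < z (ι ζ) (ι η) := by
    refine lt_of_le_of_ne (subset_union_left.trans (hyz (ι ζ) (ι η))) fun h ↦ ?_
    rw [← h] at hnz
    exact hnz.not_ge hyn
  have hzw' : z (ι ζ) (ι η) < w := by
    refine lt_of_le_of_ne ((subset_iUnion (fun p : D × D ↦ (z (ι p.1) (ι p.2)).1)
      (⟨ζ, hζD⟩, ⟨η, hηD⟩)).trans hzw) fun h ↦ ?_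
    have := hzδ η
    rw [h] at this
    exact this.not_gt (lt_strictSup w.bddAbove hδw)
  refine ⟨![y (ι ζ), z (ι ζ) (ι η), w], ?_, ?_, δ, hδT, ?_⟩
  · simp [Fin.forall_fin_succ, hyX, hzX, hwX]
  · refine Fin.strictMono_iff_lt_succ.2 ?_
    simp [Fin.forall_fin_succ, hyz', hzw']
  · refine (heq _ _ hey hyδ (hey.trans (hsup η)) (hzδ η)).trans (walkSplit_of_ne hδsup ?_)
    exact (hnz.trans_le (hL.walkStep_mem (hzδ η)).2).ne'

end Coloring

open Cardinal Order Set in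
theorem theorem1p5 (κ lam : Cardinal.{u}) (hκ : κ.IsRegular) (hlam : lam.IsRegular)
    (hle : κ ≤ lam)
    (hS : ∃ S : Set Ordinal.{u}, S ⊆ cofBelow lam κ ∧ IsStationaryIn S lam.ord ∧
      ∀ α ∈ cofBelow lam κ, ¬ IsStationaryIn (S ∩ Set.Iio α) α) :
    NegSquareBracket κ lam 3 := by
  classical
  obtain ⟨S, hScof, ⟨hω, hSstat⟩, hnon⟩ := hS
  rw [hlam.cof_ord] at hω
  have := hlam.isRegularCardinalOrder_Iio_ord
  have hα : ℵ₀ < Order.cof (Iio lam.ord) := by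
    rw [hlam.cof_Iio_ord, ← lift_aleph0.{u + 1, u}]
    exact Cardinal.lift_lt.2 hω
  -- Ladders can avoid accumulating only at limit points, and in particular not at 0.
  set S' : Set Ordinal.{u} := {δ ∈ S | IsSuccLimit δ}
  have hlim : ∀ δ ∈ S', IsSuccLimit δ := fun δ hδ ↦ hδ.2
  have hlad (γ : Ordinal.{u}) : ∃ C, γ ∈ cofBelow lam κ → IsLadder S' γ C := by
    by_cases hγ : γ ∈ cofBelow lam κ
    · obtain ⟨C, hC⟩ := exists_isLadder hlim (γ := γ) fun h ↦ hnon γ hγ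
        ⟨h.1, h.2.mono fun a ha ↦ ⟨ha.1.1, ha.2⟩⟩
      exact ⟨C, fun _ ↦ hC⟩
    · exact ⟨∅, fun h ↦ (hγ h).elim⟩
  choose C hC using hlad
  have hS' : IsStationary ((Subtype.val : Iio lam.ord → Ordinal.{u}) ⁻¹' S') := by
    refine (hSstat.inter_isClub hα (isClub_setOf_isSuccLimit hα)).mono ?_
    rintro δ ⟨hδ, hδlim⟩
    refine ⟨hδ, fun h ↦ hδlim.1 fun b hb ↦ h hb, fun w hw ↦ ?_⟩
    exact hδlim.2 ⟨w, hw.lt.trans δ.2⟩ ⟨hw.lt, fun c hwc hcδ ↦ hw.2 hwc hcδ⟩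
  have hcof : ∀ δ ∈ (Subtype.val : Iio lam.ord → Ordinal.{u}) ⁻¹' S', ∀ a < δ,
      ∃ c ∈ Subtype.val ⁻¹' C δ, a ≤ c ∧ c < δ := by
    intro δ hδ a ha
    obtain ⟨c, hc, hac⟩ := (hC δ (hScof hδ.1)).exists_le a ha
    have hcδ := (hC δ (hScof hδ.1)).lt c hc
    exact ⟨⟨c, hcδ.trans δ.2⟩, hc, hac, hcδ⟩
  have hacc : ∀ γ ∈ (Subtype.val : Iio lam.ord → Ordinal.{u}) ⁻¹' S',
      ∀ δ ∈ (Subtype.val : Iio lam.ord → Ordinal.{u}) ⁻¹' S', δ < γ →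
      ∃ a < δ, ∀ c ∈ Subtype.val ⁻¹' C γ, c < δ → c < a := by
    intro γ hγ δ hδ hlt
    obtain ⟨a, haδ, ha⟩ := (hC γ (hScof hγ.1)).exists_bound δ hδ hlt
    exact ⟨⟨a, haδ.trans δ.2⟩, haδ, fun c hc hcδ ↦ ha c hc hcδ⟩
  obtain ⟨f, hf⟩ := hS'.exists_partition hα (fun x ↦ Subtype.val ⁻¹' C x) hcof hacc
  let g : Ordinal.{u} → Iio lam.ord := fun o ↦
    if h : o < lam.ord then f ⟨o, h⟩ else ⟨0, hlam.ord_pos⟩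
  refine ⟨tripleColor C g, fun X hX ↦ eq_univ_of_forall fun ξ ↦ ?_⟩
  obtain ⟨x, hxX, hx, δ, hδ, hxδ⟩ := exists_increasing_triple hκ hlam hle
    (fun δ hδ ↦ hScof hδ.1) hlim hC hω (hf ξ) (fun δ hδ ↦ hδ.1) hX
  let s : NSubsets (PKappa κ lam) 3 := ⟨Finset.univ.image x, by
    rw [Finset.card_image_of_injective _ hx.injective, Finset.card_univ, Fintype.card_fin]⟩
  have hs : (s.1 : Set (PKappa κ lam)) = range x := by simp [s]
  refine ⟨s, ⟨x, hxX, fun i j hij ↦ hx hij, hs⟩, ?_⟩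
  rw [tripleColor_eq hx hs, hxδ]
  exact (dif_pos δ.2).trans hδ.2
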